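/- Let $0\le N\le M$ be integers. For a weakly decreasing sequence $\lambda=(\lambda_1\ge\dots\ge\lambda_n\ge 0)$ of integers let $s_\lambda(x_1,\dots,x_n)=\det\big(x_j^{\lambda_k+n-k}\big)_{j,k=1}^n\big/\prod_{1\le j<k\le n}(x_j-x_k)$ be the Schur polynomial in $n$ variables. For $\lambda\subseteq (M-N)^N$, i.e. $M-N\ge\lambda_1\ge\dots\ge\lambda_N\ge0$, let $x_1<\dots<x_N$ in $\{1,\dots,M\}$ be the particle positions determined by $\lambda_j=x_{N-j+1}-N+j-1$, let $\overline{x_1}<\dots<\overline{x_{M-N}}$ be the elements of $\{1,\dots,M\}\setminus\{x_1,\dots,x_N\}$, and put $\overline{\lambda}_j=\overline{x_{M-N-j+1}}-(M-N)+j-1$ for $1\le j\le M-N$. Let $p,q,u_1,\dots,u_M\in\mathbb{C}$ with $p\neq0$, $q^2\ne1$, and $$w_j=\frac{u_j-p^{-1}q}{1-pqu_j}\ (1\le j\le M),\qquad z_j=\frac{u_j-pq}{1-p^{-1}qu_j}\ (1\le j\le M-N),$$ all these denominators being non-zero. Put $$A=\prod_{1\le j<k\le M}f(w_j,w_k),\qquad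 B=\prod_{M-N+1\le j<k\le M}f(w_j,w_k),\qquad C=\prod_{1\le j<k\le M-N}g(z_j,z_k),$$ $$f(w_j,w_k)=\frac{p^2q(p^2-1)w_jw_k+p(p^2-q^2)w_k+p(p^2q^2-1)w_j+q(p^2-1)}{p(q^2-1)},$$ $$g(z_j,z_k)=\frac{q(1-p^2)z_jz_k+p(q^2-p^2)z_k+p(1-p^2q^2)z_j+p^2q(1-p^2)}{-p(q^2-1)},$$ and assume $B\ne0$ and $C\neq0$. Then $$\sum_{\lambda\subseteq(M-N)^N}s_{\overline{\lambda}}\Big(\frac{z_1}{-p^2},\dots,\frac{z_{M-N}}{-p^2}\Big)\,s_\lambda(w_{M-N+1},\dots,w_M)=(-p^2)^{(N-M)N}\prod_{j=1}^{M-N}\Big(\frac{1+p^{-1}qz_j}{1+pqw_j}\Big)^{M-1}\frac{A}{BC}.$$ At $q=0$ one has $z_j=w_j=u_j$, and the right-hand side (when $B,C\ne0$) equals $\prod_{j=1}^{M-N}\prod_{k=M-N+1}^{M}\big(\frac{u_j}{t}+u_k\big)$ with $t=-p^2$. Thus one recovers the classical dual Cauchy identity: for all $t\ne0$ and $u_1,\dots,u_M\in\mathbb{C}$,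 $$\sum_{\lambda\subseteq(M-N)^N}s_{\overline{\lambda}}\Big(\frac{u_1}{t},\dots,\frac{u_{M-N}}{t}\Big)s_\lambda(u_{M-N+1},\dots,u_M)=\prod_{j=1}^{M-N}\prod_{k=M-N+1}^{M}\Big(\frac{u_j}{t}+u_k\Big),$$ and, after replacing $u$ by $tu$, for all $t,u_1,\dots,u_M\in\mathbb{C}$, $$\sum_{\lambda\subseteq(M-N)^N}s_{\overline{\lambda}}(u_1,\dots,u_{M-N})\,s_\lambda(tu_{M-N+1},\dots,tu_M)=\prod_{j=1}^{M-N}\prod_{k=M-N+1}^{M}(u_j+tu_k).$$ -/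

import Mathlib

open Finset

namespace FelderhofDualCauchy

/-! ### Schur polynomials in `n` variables -/

/-- The alternant `det (X_j ^ (lam_k + n - k))` (with `1 ≤ j, k ≤ n`; here `j`, `k` count from 0). -/
noncomputable def alternant {n : ℕ} (lam : Fin n → ℕ) : MvPolynomial (Fin n) ℂ :=
  (Matrix.of fun j k : Fin n =>
    (MvPolynomial.X j : MvPolynomial (Fin n) ℂ) ^ (lam k + (n - 1 - (k : ℕ)))).det

/-- The product `∏_{j < k} (X_j - X_k)`. -/
noncomputable def vandermondeProd (n : ℕ) : MvPolynomial (Fin n) ℂ :=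
  ∏ j : Fin n, ∏ k ∈ Ioi j, (MvPolynomial.X j - MvPolynomial.X k)

/-- The alternant is divisible by the Vandermonde product. -/
theorem vandermondeProd_dvd_alternant {n : ℕ} (lam : Fin n → ℕ) :
    vandermondeProd n ∣ alternant lam := by
  classical
  set P : Polynomial (MvPolynomial (Fin n) ℂ) :=
    ∏ i : Fin n, (Polynomial.X - Polynomial.C (MvPolynomial.X i)) with hP
  have hmon : P.Monic := Polynomial.monic_prod_of_monic _ _ fun i _ => Polynomial.monic_X_sub_C _
  have hdeg : P.natDegree = n := by
    rw [hP, Polynomial.natDegree_prod_of_monic _ _ fun i _ => Polynomial.monic_X_sub_C _]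
    simp
  have hroot : ∀ j : Fin n, P.eval (MvPolynomial.X j) = 0 := fun j => by
    rw [hP, Polynomial.eval_prod]
    exact Finset.prod_eq_zero (mem_univ j) (by simp)
  have hpow : ∀ (a : ℕ) (j : Fin n), (MvPolynomial.X j : MvPolynomial (Fin n) ℂ) ^ a =
      ∑ i : Fin n, MvPolynomial.X j ^ (i : ℕ) * (Polynomial.X ^ a %ₘ P).coeff i := by
    intro a j
    rcases Nat.eq_zero_or_pos n with h0 | hn
    · subst h0; exact j.elim0
    have h1 := congrArg (Polynomial.eval (MvPolynomial.X j))
      (Polynomial.modByMonic_add_div (Polynomial.X ^ a) P)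
    rw [Polynomial.eval_add, Polynomial.eval_mul, hroot j, zero_mul, add_zero,
      Polynomial.eval_pow, Polynomial.eval_X] at h1
    have hlt : (Polynomial.X ^ a %ₘ P).natDegree < n := by
      have := Polynomial.natDegree_modByMonic_lt (Polynomial.X ^ a) hmon
        (by intro h; rw [h, Polynomial.natDegree_one] at hdeg; omega)
      omega
    rw [← h1, Polynomial.eval_eq_sum_range' hlt, ← Fin.sum_univ_eq_sum_range
      (fun i => (Polynomial.X ^ a %ₘ P).coeff i * (MvPolynomial.X j) ^ i)]
    exact Finset.sum_congr rfl fun i _ => mul_comm _ _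
  have hmat : (Matrix.of fun j k : Fin n =>
      (MvPolynomial.X j : MvPolynomial (Fin n) ℂ) ^ (lam k + (n - 1 - (k : ℕ)))) =
      Matrix.vandermonde (fun j : Fin n => (MvPolynomial.X j : MvPolynomial (Fin n) ℂ)) *
      Matrix.of fun i k : Fin n =>
        (Polynomial.X ^ (lam k + (n - 1 - (k : ℕ))) %ₘ P).coeff (i : ℕ) := by
    ext1 j k
    rw [Matrix.mul_apply]
    simpa [Matrix.vandermonde_apply] using hpow _ j
  have hdvd : vandermondeProd n ∣
      (Matrix.vandermonde fun j : Fin n => (MvPolynomial.X j : MvPolynomial (Fin n) ℂ)).det := by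
    rw [Matrix.det_vandermonde, vandermondeProd]
    refine Finset.prod_dvd_prod_of_dvd _ _ fun i _ => Finset.prod_dvd_prod_of_dvd _ _ fun j _ => ?_
    exact ⟨-1, by ring⟩
  rw [alternant, hmat, Matrix.det_mul]
  exact hdvd.mul_right _

/-- The Schur polynomial `s_lam(X_1, …, X_n)`, i.e. the polynomial
`det (X_j ^ (lam_k + n - k)) / ∏_{j < k} (X_j - X_k)`. -/
noncomputable def schurPoly {n : ℕ} (lam : Fin n → ℕ) : MvPolynomial (Fin n) ℂ :=
  (vandermondeProd_dvd_alternant lam).choose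

theorem vandermondeProd_mul_schurPoly {n : ℕ} (lam : Fin n → ℕ) :
    vandermondeProd n * schurPoly lam = alternant lam :=
  (vandermondeProd_dvd_alternant lam).choose_spec.symm

/-- The value `s_lam(x_1, …, x_n)` of the Schur polynomial at `x`. -/
noncomputable def schur {n : ℕ} (lam : Fin n → ℕ) (x : Fin n → ℂ) : ℂ :=
  MvPolynomial.eval x (schurPoly lam)

/-! ### Young diagrams, particles and holes -/

open Classical in
/-- The Young diagrams `lam ⊆ L ^ N`, i.e. `L ≥ lam_1 ≥ … ≥ lam_N ≥ 0`. -/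
noncomputable def boxPartitions (N L : ℕ) : Finset (Fin N → ℕ) :=
  {lam ∈ Fintype.piFinset fun _ : Fin N => Finset.range (L + 1) | Antitone lam}

/-- The particle positions `x_1 < … < x_N` of `lam`, given by `lam_j = x_{N-j+1} - N + j - 1`. -/
def particles {N : ℕ} (lam : Fin N → ℕ) : Finset ℕ :=
  Finset.univ.image fun j : Fin N => lam j + (N - (j : ℕ))

/-- The hole positions: the sites of `{1, …, M}` that carry no particle. -/
def holes (M : ℕ) {N : ℕ} (lam : Fin N → ℕ) : Finset ℕ :=
  Finset.Icc 1 M \ particles lam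

/-- The `i`-th smallest hole position, `i = 1, …, M - N`. -/
noncomputable def holePos (M : ℕ) {N : ℕ} (lam : Fin N → ℕ) (i : ℕ) : ℕ :=
  Nat.nth (fun x => x ∈ holes M lam) (i - 1)

/-- The Young diagram `\bar lam` of the hole configuration of `lam`: for `j = 1, …, M - N`,
`\bar lam_j = \bar x_{(M-N)-j+1} - (M-N) + j - 1` (the code index is `j - 1`). -/
noncomputable def barPartition (M : ℕ) {N : ℕ} (lam : Fin N → ℕ) : Fin (M - N) → ℕ :=
  fun j => holePos M lam (M - N - (j : ℕ)) - (M - N - (j : ℕ))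

/-! ### The two changes of variables and the product side -/

/-- `w = (u - p⁻¹ q) / (1 - p q u)`. -/
noncomputable def wVar (p q u : ℂ) : ℂ := (u - p⁻¹ * q) / (1 - p * q * u)

/-- `z = (u - p q) / (1 - p⁻¹ q u)`. -/
noncomputable def zVar (p q u : ℂ) : ℂ := (u - p * q) / (1 - p⁻¹ * q * u)

/-- The factor of `A` and `B` attached to a pair `(w_j, w_k)`. -/
noncomputable def wFactor (p q wj wk : ℂ) : ℂ :=
  (p ^ 2 * q * (p ^ 2 - 1) * wj * wk + p * (p ^ 2 - q ^ 2) * wk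
    + p * (p ^ 2 * q ^ 2 - 1) * wj + q * (p ^ 2 - 1)) / (p * (q ^ 2 - 1))

/-- The factor of `C` attached to a pair `(z_j, z_k)`. -/
noncomputable def zFactor (p q zj zk : ℂ) : ℂ :=
  (q * (1 - p ^ 2) * zj * zk + p * (q ^ 2 - p ^ 2) * zk
    + p * (1 - p ^ 2 * q ^ 2) * zj + p ^ 2 * q * (1 - p ^ 2)) / (-p * (q ^ 2 - 1))

/-- The product of `wFactor p q w_j w_k` over `1 ≤ j < k ≤ M`. -/
noncomputable def prodA (M : ℕ) (p q : ℂ) (u : ℕ → ℂ) : ℂ :=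
  ∏ j ∈ Finset.Icc 1 M, ∏ k ∈ Finset.Ioc j M, wFactor p q (wVar p q (u j)) (wVar p q (u k))

/-- The product of `wFactor p q w_j w_k` over `M - N + 1 ≤ j < k ≤ M`. -/
noncomputable def prodB (M N : ℕ) (p q : ℂ) (u : ℕ → ℂ) : ℂ :=
  ∏ j ∈ Finset.Icc (M - N + 1) M, ∏ k ∈ Finset.Ioc j M,
    wFactor p q (wVar p q (u j)) (wVar p q (u k))

/-- The product of `zFactor p q z_j z_k` over `1 ≤ j < k ≤ M - N`. -/
noncomputable def prodC (M N : ℕ) (p q : ℂ) (u : ℕ → ℂ) : ℂ :=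
  ∏ j ∈ Finset.Icc 1 (M - N), ∏ k ∈ Finset.Ioc j (M - N),
    zFactor p q (zVar p q (u j)) (zVar p q (u k))

/-- `∑_{lam ⊆ (M-N)^N} s_{\bar lam}(x_1, …, x_{M-N}) s_lam(y_{M-N+1}, …, y_M)`. -/
noncomputable def schurSum (M N : ℕ) (x y : ℕ → ℂ) : ℂ :=
  ∑ lam ∈ boxPartitions N (M - N),
    schur (barPartition M lam) (fun j : Fin (M - N) => x ((j : ℕ) + 1)) *
      schur lam (fun k : Fin N => y (M - N + 1 + (k : ℕ)))

/-- The right-hand side of the dual Cauchy identity of the Felderhof model. -/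
noncomputable def dualCauchyRHS (M N : ℕ) (p q : ℂ) (u : ℕ → ℂ) : ℂ :=
  (-p ^ 2) ^ (((N : ℤ) - (M : ℤ)) * (N : ℤ)) *
    (∏ j ∈ Finset.Icc 1 (M - N),
      ((1 + p⁻¹ * q * zVar p q (u j)) / (1 + p * q * wVar p q (u j))) ^ (M - 1)) *
    (prodA M p q u / (prodB M N p q u * prodC M N p q u))

end FelderhofDualCauchy

/-!
The theorem rests on the classical dual Cauchy identity
`∑ lam, s_{bar lam}(x) s_lam(y) = ∏_{j, k} (x_j + y_k)` (`sum_schur_mul_schur`), whose right-hand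
side is then matched with the product side of the Felderhof model.

The dual Cauchy identity is the Laplace expansion of the Vandermonde determinant in the `M`
variables `-x_1, …, -x_{M-N}, y_1, …, y_N`. That determinant is, up to sign, the product of the two
smaller Vandermonde determinants and of all `x_j + y_k`. Expanding it along the blocks of rows `x`
and `y` (`det_eq_sum_powersetCard`) gives a sum over the sets `T` of exponents that go to the
`x`-block; `T` is the set of holes and its complement the set of particles of a partition `lam`, and
the two minors are the alternants of `bar lam` and `lam` (`sum_boxPartitions_eq_sum_powersetCard`).
The sign of the term is `(-1)` to the number of inversions of the shuffle, which is the sum of `T`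
minus `0 + 1 + ⋯ + (M - N - 1)` (`sign_finSumEquivOfFinset`); the signs of the variables `-x_j`
cancel it exactly. The smaller Vandermonde determinants are cancelled in a polynomial ring, where
they are non-zero, and the result is then evaluated.

On the product side, put `r_j = (1 + p⁻¹ q z_j) / (1 + p q w_j)`. In terms of `u`, the factors
`f = wFactor p q` and `g = zFactor p q` have the same numerator, and the denominators give
`r_j r_k f(w_j, w_k) = g(z_j, z_k)` as well as `r_j f(w_j, w_k) = -p² (z_j / (-p²) + w_k)`. Each low
index `j ≤ M - N` occurs in `M - 1` pairs, so `∏ r_j ^ (M - 1)` turns the pairs of low indices in `A`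
into `C` and the mixed pairs into the classical product; the remaining pairs form `B`
(`dualCauchyRHS_eq_prod`).
-/

namespace FelderhofDualCauchy


/-! ### The product side -/

theorem wFactor_wVar {p q u v : ℂ} (hp : p ≠ 0) (hq : q ^ 2 ≠ 1)
    (hu : 1 - p * q * u ≠ 0) (hv : 1 - p * q * v ≠ 0) :
    wFactor p q (wVar p q u) (wVar p q v) =
      ((u - p * q) * (1 - p * q * v) - (p * v - q) * (p - q * u)) /
        ((1 - p * q * u) * (1 - p * q * v)) := by
  have hq' : q ^ 2 - 1 ≠ 0 := sub_ne_zero.2 hq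
  unfold wFactor wVar
  generalize hD : 1 - p * q * u = D at *
  generalize hE : 1 - p * q * v = E at *
  field_simp
  subst hD hE
  ring

/-- The numerator is the one of `wFactor_wVar`: the two kinds of factors differ only in the
denominators. -/
theorem zFactor_zVar {p q u v : ℂ} (hp : p ≠ 0) (hq : q ^ 2 ≠ 1)
    (hu : 1 - p⁻¹ * q * u ≠ 0) (hv : 1 - p⁻¹ * q * v ≠ 0) :
    zFactor p q (zVar p q u) (zVar p q v) =
      ((u - p * q) * (1 - p * q * v) - (p * v - q) * (p - q * u)) /
        ((1 - p⁻¹ * q * u) * (1 - p⁻¹ * q * v)) := by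
  have hq' : q ^ 2 - 1 ≠ 0 := sub_ne_zero.2 hq
  unfold zFactor zVar
  generalize hD : 1 - p⁻¹ * q * u = D at *
  generalize hE : 1 - p⁻¹ * q * v = E at *
  field_simp
  subst hD hE
  field_simp
  ring

theorem ratio_zVar_wVar {p q u : ℂ} (hp : p ≠ 0) (hq : q ^ 2 ≠ 1)
    (hu : 1 - p * q * u ≠ 0) (hu' : 1 - p⁻¹ * q * u ≠ 0) :
    (1 + p⁻¹ * q * zVar p q u) / (1 + p * q * wVar p q u) =
      (1 - p * q * u) / (1 - p⁻¹ * q * u) := by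
  have hq' : 1 - q ^ 2 ≠ 0 := sub_ne_zero.2 hq.symm
  have hw : 1 + p * q * wVar p q u = (1 - q ^ 2) / (1 - p * q * u) := by
    rw [wVar, eq_div_iff hu, add_mul, mul_assoc (p * q), div_mul_cancel₀ _ hu]
    field_simp
    ring
  have hz : 1 + p⁻¹ * q * zVar p q u = (1 - q ^ 2) / (1 - p⁻¹ * q * u) := by
    rw [zVar, eq_div_iff hu', add_mul, mul_assoc (p⁻¹ * q), div_mul_cancel₀ _ hu']
    field_simp
    ring
  rw [hw, hz, div_div_div_cancel_left' _ _ hq']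

/-- Up to the ratio, a mixed factor is the linear form of the classical product. -/
theorem ratio_mul_wFactor {p q u v : ℂ} (hp : p ≠ 0) (hq : q ^ 2 ≠ 1)
    (hu : 1 - p * q * u ≠ 0) (hu' : 1 - p⁻¹ * q * u ≠ 0) (hv : 1 - p * q * v ≠ 0) :
    (1 + p⁻¹ * q * zVar p q u) / (1 + p * q * wVar p q u) *
      wFactor p q (wVar p q u) (wVar p q v) =
      -p ^ 2 * (zVar p q u / (-p ^ 2) + wVar p q v) := by
  rw [ratio_zVar_wVar hp hq hu hu', wFactor_wVar hp hq hu hv, wVar, zVar]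
  generalize hD : 1 - p * q * u = D at *
  generalize hE : 1 - p * q * v = E at *
  generalize hF : 1 - p⁻¹ * q * u = F at *
  field_simp
  subst hE hF
  field_simp
  ring

theorem ratio_mul_ratio_mul_wFactor {p q u v : ℂ} (hp : p ≠ 0) (hq : q ^ 2 ≠ 1)
    (hu : 1 - p * q * u ≠ 0) (hu' : 1 - p⁻¹ * q * u ≠ 0)
    (hv : 1 - p * q * v ≠ 0) (hv' : 1 - p⁻¹ * q * v ≠ 0) :
    (1 + p⁻¹ * q * zVar p q u) / (1 + p * q * wVar p q u) *
      ((1 + p⁻¹ * q * zVar p q v) / (1 + p * q * wVar p q v)) *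
      wFactor p q (wVar p q u) (wVar p q v) = zFactor p q (zVar p q u) (zVar p q v) := by
  rw [ratio_zVar_wVar hp hq hu hu', ratio_zVar_wVar hp hq hv hv', wFactor_wVar hp hq hu hv,
    zFactor_zVar hp hq hu' hv']
  generalize 1 - p * q * u = D at *
  generalize 1 - p * q * v = E at *
  generalize 1 - p⁻¹ * q * u = F at *
  generalize 1 - p⁻¹ * q * v = G at *
  field_simp

theorem prod_Icc_prod_Ioc_mul {R : Type*} [CommMonoid R] (r : ℕ → R) (L : ℕ) :
    ∏ j ∈ Icc 1 L, ∏ k ∈ Ioc j L, (r j * r k) = ∏ j ∈ Icc 1 L, r j ^ (L - 1) := by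
  induction L with
  | zero => simp
  | succ L ih =>
    rw [prod_Icc_succ_top (by omega), prod_Icc_succ_top (by omega)]
    have h : ∀ j ∈ Icc 1 L, ∏ k ∈ Ioc j (L + 1), (r j * r k) =
        (∏ k ∈ Ioc j L, (r j * r k)) * (r j * r (L + 1)) := fun j hj =>
      prod_Ioc_succ_top (by simp only [mem_Icc] at hj; omega) _
    rw [prod_congr rfl h, prod_mul_distrib, ih, Ioc_self, prod_empty, mul_one, prod_mul_distrib,
      ← mul_assoc, ← prod_mul_distrib]
    congr 1
    · refine prod_congr rfl fun j hj => ?_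
      rw [← pow_succ]
      congr 1
      simp only [mem_Icc] at hj
      omega
    · simp

/-- The three factors collect the pairs `j < k ≤ L`, `j ≤ L < k` and `L < j < k`. -/
theorem prod_pairs_split {R : Type*} [CommMonoid R] (f : ℕ → ℕ → R) {L M : ℕ} (h : L ≤ M) :
    ∏ j ∈ Icc 1 M, ∏ k ∈ Ioc j M, f j k =
      (∏ j ∈ Icc 1 L, ∏ k ∈ Ioc j L, f j k) * (∏ j ∈ Icc 1 L, ∏ k ∈ Icc (L + 1) M, f j k) *
        ∏ j ∈ Icc (L + 1) M, ∏ k ∈ Ioc j M, f j k := by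
  have hI : ∀ a b : ℕ, Icc (a + 1) b = Ioc a b := fun a b => by ext; simp
  have h1 : Icc 1 M = Ioc 0 M := hI 0 M
  have h2 : Icc 1 L = Ioc 0 L := hI 0 L
  rw [h1, h2, hI, ← prod_Ioc_consecutive _ (Nat.zero_le L) h, ← prod_mul_distrib]
  congr 1
  refine prod_congr rfl fun j hj => ?_
  rw [prod_Ioc_consecutive _ (mem_Ioc.1 hj).2 h]

theorem dualCauchyRHS_eq_prod {M N : ℕ} (hNM : N ≤ M) {p q : ℂ} {u : ℕ → ℂ} (hp : p ≠ 0)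
    (hq : q ^ 2 ≠ 1) (hw : ∀ j ∈ Icc 1 M, 1 - p * q * u j ≠ 0)
    (hz : ∀ j ∈ Icc 1 (M - N), 1 - p⁻¹ * q * u j ≠ 0)
    (hB : prodB M N p q u ≠ 0) (hC : prodC M N p q u ≠ 0) :
    dualCauchyRHS M N p q u =
      ∏ j ∈ Icc 1 (M - N), ∏ k ∈ Icc (M - N + 1) M,
        (zVar p q (u j) / (-p ^ 2) + wVar p q (u k)) := by
  set L := M - N with hL
  set r : ℕ → ℂ := fun j =>
    (1 + p⁻¹ * q * zVar p q (u j)) / (1 + p * q * wVar p q (u j)) with hr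
  have hlow : ∀ {j}, j ∈ Icc 1 L → j ∈ Icc 1 M := fun hj => by
    simp only [mem_Icc] at hj ⊢; omega
  have hA : (∏ j ∈ Icc 1 L, r j ^ (M - 1)) * prodA M p q u =
      prodC M N p q u * (∏ j ∈ Icc 1 L, ∏ k ∈ Icc (L + 1) M,
        (-p ^ 2 * (zVar p q (u j) / (-p ^ 2) + wVar p q (u k)))) * prodB M N p q u := by
    -- `M - 1` splits into the `L - 1` other low indices and the `N` high ones
    have hpow : ∏ j ∈ Icc 1 L, r j ^ (M - 1) =
        (∏ j ∈ Icc 1 L, ∏ k ∈ Ioc j L, (r j * r k)) *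
          ∏ j ∈ Icc 1 L, ∏ _k ∈ Icc (L + 1) M, r j := by
      rw [prod_Icc_prod_Ioc_mul, ← prod_mul_distrib]
      refine prod_congr rfl fun j hj => ?_
      rw [prod_const, Nat.card_Icc, ← pow_add]
      congr 1
      simp only [mem_Icc] at hj
      omega
    rw [hpow, prodA, prod_pairs_split _ (Nat.sub_le M N : L ≤ M), prodC, prodB, ← hL,
      ← mul_assoc, mul_mul_mul_comm]
    congr 1
    simp only [← prod_mul_distrib]
    refine prod_congr rfl fun j hj => ?_
    congr 1
    · refine prod_congr rfl fun k hk => ?_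
      have hk' : k ∈ Icc 1 L := by simp only [mem_Icc, mem_Ioc] at hj hk ⊢; omega
      exact ratio_mul_ratio_mul_wFactor hp hq (hw j (hlow hj)) (hz j hj) (hw k (hlow hk'))
        (hz k hk')
    · refine prod_congr rfl fun k hk => ?_
      exact ratio_mul_wFactor hp hq (hw j (hlow hj)) (hz j hj)
        (hw k (by simp only [mem_Icc] at hk ⊢; omega))
  have hp2 : (-p ^ 2 : ℂ) ≠ 0 := neg_ne_zero.2 (pow_ne_zero _ hp)
  have hconst : ∏ _j ∈ Icc 1 L, ∏ _k ∈ Icc (L + 1) M, (-p ^ 2 : ℂ) = (-p ^ 2) ^ (L * N) := by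
    rw [prod_const, prod_const, Nat.card_Icc, Nat.card_Icc, ← pow_mul, mul_comm]
    congr 2
    omega
  have hexp : ((N : ℤ) - (M : ℤ)) * (N : ℤ) = -((L * N : ℕ) : ℤ) := by
    rw [hL]; push_cast [hNM]; ring
  simp only [prod_mul_distrib, hconst] at hA
  rw [dualCauchyRHS, ← hL, hexp, zpow_neg, zpow_natCast, mul_assoc, ← mul_div_assoc,
    hA, inv_mul_eq_div, div_div, div_eq_iff
      (mul_ne_zero (mul_ne_zero hB hC) (pow_ne_zero _ hp2))]
  ring

theorem zVar_zero (p u : ℂ) : zVar p 0 u = u := by simp [zVar]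

theorem wVar_zero (p u : ℂ) : wVar p 0 u = u := by simp [wVar]


/-! ### Laplace expansion along complementary blocks -/

/-- Expansion of a determinant along a partition of its rows into two blocks, with the columns
identified with a linear order through `e₀`. The sum runs over the set `T` of columns that are
assigned to the first block of rows. -/
theorem det_eq_sum_powersetCard {R α : Type*} [CommRing R] [Fintype α] [LinearOrder α]
    {m n : ℕ} (A : Matrix (Fin m ⊕ Fin n) α R) (e₀ : Fin m ⊕ Fin n ≃ α)
    (hcard : ∀ T ∈ powersetCard m (univ : Finset α), #T = m ∧ #Tᶜ = n) :
    (A.submatrix id e₀).det = ∑ T ∈ (powersetCard m (univ : Finset α)).attach,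
      (Equiv.Perm.sign ((finSumEquivOfFinset (hcard T T.2).1 (hcard T T.2).2).trans e₀.symm) : R) *
        ((A.submatrix Sum.inl (T.1.orderEmbOfFin (hcard T T.2).1)).det *
          (A.submatrix Sum.inr (T.1ᶜ.orderEmbOfFin (hcard T T.2).2)).det) := by
  classical
  have hmem : ∀ σ : Equiv.Perm (Fin m ⊕ Fin n),
      (univ.image fun i : Fin m => e₀ (σ (Sum.inl i))) ∈ powersetCard m (univ : Finset α) := by
    intro σ
    rw [mem_powersetCard_univ, card_image_of_injective, card_univ, Fintype.card_fin]
    exact e₀.injective.comp (σ.injective.comp Sum.inl_injective)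
  rw [← Matrix.det_transpose, Matrix.det_apply',
    ← sum_fiberwise_of_maps_to (g := fun σ => (⟨_, hmem σ⟩ : powersetCard m (univ : Finset α)))
      (t := (powersetCard m (univ : Finset α)).attach) (fun σ _ => mem_attach _ _)]
  refine sum_congr rfl fun T _ => ?_
  obtain ⟨h1, h2⟩ := hcard T T.2
  set e := finSumEquivOfFinset h1 h2 with he
  rw [← Matrix.det_transpose (A.submatrix Sum.inl _), ← Matrix.det_transpose (A.submatrix Sum.inr _),
    Matrix.det_apply', Matrix.det_apply', sum_mul_sum, ← sum_product', mul_sum]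
  symm
  refine sum_bij (fun τ _ => (Equiv.Perm.sumCongr τ.1 τ.2).trans (e.trans e₀.symm)) ?_ ?_ ?_ ?_
  · rintro ⟨τ₁, τ₂⟩ -
    rw [mem_filter]
    refine ⟨mem_univ _, Subtype.ext ?_⟩
    refine eq_of_subset_of_card_le ?_ ?_
    · intro a ha
      obtain ⟨i, -, rfl⟩ := mem_image.1 ha
      simp [he]
    · rw [h1, card_image_of_injective, card_univ, Fintype.card_fin]
      exact e₀.injective.comp ((Equiv.injective _).comp Sum.inl_injective)
  · rintro ⟨τ₁, τ₂⟩ - ⟨τ₁', τ₂'⟩ - h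
    have h' : Equiv.Perm.sumCongr τ₁ τ₂ = Equiv.Perm.sumCongr τ₁' τ₂' := by
      ext x
      have := Equiv.congr_fun h x
      simp only [Equiv.trans_apply, EmbeddingLike.apply_eq_iff_eq] at this
      rw [this]
    exact Equiv.Perm.sumCongrHom_injective (a₁ := (τ₁, τ₂)) (a₂ := (τ₁', τ₂')) h'
  · intro σ hσ
    rw [mem_filter] at hσ
    have hT := congrArg Subtype.val hσ.2
    simp only at hT
    have hmaps : Set.MapsTo ((σ.trans (e₀.trans e.symm) : Equiv.Perm (Fin m ⊕ Fin n)))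
        (Set.range Sum.inl) (Set.range Sum.inl) := by
      rintro _ ⟨i, rfl⟩
      have hi : e₀ (σ (Sum.inl i)) ∈ T.1 := by
        rw [← hT]; exact mem_image_of_mem _ (mem_univ i)
      rw [← mem_coe, ← range_orderEmbOfFin T.1 h1] at hi
      obtain ⟨k, hk⟩ := hi
      refine ⟨k, ?_⟩
      simp only [Equiv.trans_apply]
      rw [Equiv.eq_symm_apply, ← hk, he, finSumEquivOfFinset_inl]
    obtain ⟨τ, hτ⟩ := Equiv.Perm.mem_sumCongrHom_range_of_perm_mapsTo_inl hmaps
    refine ⟨τ, mem_univ _, ?_⟩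
    change Equiv.Perm.sumCongr τ.1 τ.2 = _ at hτ
    rw [hτ]
    ext x
    simp
  · rintro ⟨τ₁, τ₂⟩ -
    rw [Fintype.prod_sum_type]
    simp only [Equiv.Perm.sign_trans, Matrix.transpose_apply, Matrix.submatrix_apply,
      Equiv.trans_apply, Equiv.apply_symm_apply, id, Equiv.Perm.sumCongr_apply, Sum.map_inl,
      Sum.map_inr, he, finSumEquivOfFinset_inl, finSumEquivOfFinset_inr,
      Equiv.Perm.sign_sumCongr]
    push_cast
    ring

theorem prod_pairs_fin_add {R : Type*} [CommMonoid R] {m n : ℕ}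
    (F : Fin (m + n) → Fin (m + n) → R) :
    ∏ i, ∏ j ∈ Ioi i, F i j =
      (∏ i : Fin m, ∏ j ∈ Ioi i, F (Fin.castAdd n i) (Fin.castAdd n j)) *
        (∏ i : Fin m, ∏ k : Fin n, F (Fin.castAdd n i) (Fin.natAdd m k)) *
        ∏ i : Fin n, ∏ j ∈ Ioi i, F (Fin.natAdd m i) (Fin.natAdd m j) := by
  have hI : ∀ {l : ℕ} (i : Fin l) (G : Fin l → R),
      ∏ j ∈ Ioi i, G j = ∏ j, if i < j then G j else 1 := fun i G => by
    rw [← prod_filter]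
    congr 1
    ext
    simp
  rw [Fin.prod_univ_add, ← prod_mul_distrib]
  congr 1
  · refine prod_congr rfl fun i _ => ?_
    rw [hI, Fin.prod_univ_add, hI]
    congr 1
    refine prod_congr rfl fun k _ => if_pos ?_
    rw [Fin.lt_def, Fin.val_castAdd, Fin.val_natAdd]
    omega
  · refine prod_congr rfl fun i _ => ?_
    rw [hI, Fin.prod_univ_add, hI, prod_eq_one, one_mul]
    · simp
    · intro j _
      refine if_neg ?_
      rw [Fin.lt_def, Fin.val_castAdd, Fin.val_natAdd]
      omega

theorem card_compl_lt_orderEmbOfFin {m n M : ℕ} (T : Finset (Fin M)) (h1 : #T = m)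
    (h2 : #Tᶜ = n) (i : Fin m) :
    #{k : Fin n | Tᶜ.orderEmbOfFin h2 k < T.orderEmbOfFin h1 i} + (i : ℕ) =
      (T.orderEmbOfFin h1 i : ℕ) := by
  set a := T.orderEmbOfFin h1 i with ha
  have hT : #{x ∈ T | x < a} = (i : ℕ) := by
    rw [← Fin.card_Iio i, ← card_map (T.orderEmbOfFin h1).toEmbedding]
    congr 1
    ext x
    rw [mem_filter, mem_map, ← mem_coe (s := T), ← range_orderEmbOfFin T h1]
    constructor
    · rintro ⟨⟨j, rfl⟩, hj⟩
      exact ⟨j, mem_Iio.2 ((T.orderEmbOfFin h1).lt_iff_lt.1 hj), rfl⟩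
    · rintro ⟨j, hj, rfl⟩
      exact ⟨⟨j, rfl⟩, (T.orderEmbOfFin h1).lt_iff_lt.2 (mem_Iio.1 hj)⟩
  have hTc : #{x ∈ Tᶜ | x < a} = #{k : Fin n | Tᶜ.orderEmbOfFin h2 k < a} := by
    rw [← card_map (Tᶜ.orderEmbOfFin h2).toEmbedding]
    congr 1
    ext x
    rw [mem_filter, mem_map, ← mem_coe (s := Tᶜ), ← range_orderEmbOfFin Tᶜ h2]
    constructor
    · rintro ⟨⟨j, rfl⟩, hj⟩
      exact ⟨j, by simpa using hj, rfl⟩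
    · rintro ⟨j, hj, rfl⟩
      exact ⟨⟨j, rfl⟩, by simpa using hj⟩
  rw [← hTc, ← hT, ← Fin.card_Iio a, add_comm, ← card_union_of_disjoint]
  · rw [← filter_union, union_compl]
    congr 1
    ext
    simp
  · exact disjoint_filter_filter disjoint_compl_right

/-- The permutation that lists an `m`-subset in increasing order and then its complement has one
inversion for each pair of an element of the subset and a smaller element of the complement; below
the `i`-th element `h i` of the subset there are `h i - i` of these. -/
theorem sign_finSumEquivOfFinset {m n M : ℕ} (hM : m + n = M) (T : Finset (Fin M))
    (h1 : #T = m) (h2 : #Tᶜ = n) :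
    Equiv.Perm.sign ((finSumEquivOfFinset h1 h2).trans
      (finSumFinEquiv.trans (finCongr hM)).symm) *
      (-1) ^ (∑ i : Fin m, (i : ℕ)) = (-1) ^ ∑ i : Fin m, (T.orderEmbOfFin h1 i : ℕ) := by
  subst hM
  rw [← Equiv.Perm.sign_permCongr finSumFinEquiv, Equiv.Perm.sign_eq_prod_prod_Ioi,
    prod_pairs_fin_add]
  have hl : ∀ i, Equiv.permCongr finSumFinEquiv ((finSumEquivOfFinset h1 h2).trans
      (finSumFinEquiv.trans (finCongr rfl)).symm) (Fin.castAdd n i) = T.orderEmbOfFin h1 i := by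
    intro i
    simp [Equiv.permCongr_apply]
  have hr : ∀ i, Equiv.permCongr finSumFinEquiv ((finSumEquivOfFinset h1 h2).trans
      (finSumFinEquiv.trans (finCongr rfl)).symm) (Fin.natAdd m i) = Tᶜ.orderEmbOfFin h2 i := by
    intro i
    simp [Equiv.permCongr_apply]
  simp only [hl, hr, OrderEmbedding.lt_iff_lt]
  rw [prod_eq_one (s := (univ : Finset (Fin m))) fun i _ => prod_eq_one fun j hj =>
      if_pos (mem_Ioi.1 hj), prod_eq_one (s := (univ : Finset (Fin n))) fun i _ =>
      prod_eq_one fun j hj => if_pos (mem_Ioi.1 hj), one_mul, mul_one, ← prod_pow_eq_pow_sum,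
    ← prod_pow_eq_pow_sum, ← prod_mul_distrib]
  refine prod_congr rfl fun i _ => ?_
  rw [← card_compl_lt_orderEmbOfFin T h1 h2 i, pow_add, prod_ite, prod_const_one, one_mul,
    prod_const]
  congr 3
  ext k
  have : Tᶜ.orderEmbOfFin h2 k ≠ T.orderEmbOfFin h1 i := fun h =>
    mem_compl.1 (orderEmbOfFin_mem Tᶜ h2 k) (h ▸ orderEmbOfFin_mem T h1 i)
  simp only [mem_filter, mem_univ, true_and, not_lt]
  exact ⟨fun h => lt_of_le_of_ne h this, le_of_lt⟩


/-! ### Schur polynomials and the Laplace expansion of a Vandermonde determinant -/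

theorem prod_Ioi_sub_eq_sign_revPerm_mul_det_vandermonde {R : Type*} [CommRing R] {n : ℕ}
    (x : Fin n → R) :
    ∏ j, ∏ k ∈ Ioi j, (x j - x k) =
      ((Equiv.Perm.sign (Fin.revPerm : Equiv.Perm (Fin n)) : ℤ) : R) *
        (Matrix.vandermonde x).det := by
  rw [Matrix.det_vandermonde, ← Equiv.Perm.prod_Ioi_comp_eq_sign_mul_prod
    (f := fun i j => x j - x i) _ fun i j => (neg_sub _ _).symm,
    prod_comm' (t' := univ) (s' := fun k => Iio k) (by simp)]
  refine Fintype.prod_equiv Fin.revPerm _ _ fun k => ?_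
  refine prod_bij (fun i _ => Fin.rev i) ?_ ?_ ?_ ?_
  · intro i hi
    simpa [Fin.rev_lt_rev] using hi
  · intro i _ j _ h
    exact Fin.rev_injective h
  · intro j hj
    exact ⟨Fin.rev j, by simpa [Fin.lt_rev_iff, Fin.rev_lt_iff] using hj, by simp⟩
  · intro i _
    simp

/-- The bialternant formula with the exponents in increasing order; then the denominator is
Mathlib's Vandermonde determinant. -/
theorem det_vandermonde_mul_aeval_schurPoly {R : Type*} [CommRing R] [Algebra ℂ R] {n : ℕ}
    (lam : Fin n → ℕ) (x : Fin n → R) :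
    (Matrix.vandermonde x).det * MvPolynomial.aeval x (schurPoly lam) =
      (Matrix.of fun j k : Fin n => x j ^ (lam k.rev + (k : ℕ))).det := by
  have h := congrArg (MvPolynomial.aeval x) (vandermondeProd_mul_schurPoly lam)
  rw [map_mul, vandermondeProd, alternant, AlgHom.map_det, map_prod] at h
  simp only [map_prod, map_sub, MvPolynomial.aeval_X] at h
  rw [prod_Ioi_sub_eq_sign_revPerm_mul_det_vandermonde] at h
  have h2 : (MvPolynomial.aeval x).mapMatrix (Matrix.of fun j k : Fin n =>
      (MvPolynomial.X j : MvPolynomial (Fin n) ℂ) ^ (lam k + (n - 1 - (k : ℕ)))) =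
      (Matrix.of fun j k : Fin n => x j ^ (lam k.rev + (k : ℕ))).submatrix id Fin.revPerm := by
    ext j k
    simp only [AlgHom.mapMatrix_apply, Matrix.map_apply, Matrix.of_apply, map_pow,
      MvPolynomial.aeval_X, Matrix.submatrix_apply, id, Fin.revPerm_apply, Fin.rev_rev]
    congr 2
    rw [Fin.val_rev]
    omega
  rw [h2, Matrix.det_permute', mul_assoc] at h
  have hs : IsUnit ((Equiv.Perm.sign (Fin.revPerm : Equiv.Perm (Fin n)) : ℤ) : R) :=
    (Units.isUnit _).map (Int.castRingHom R)
  exact hs.mul_left_cancel h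

theorem det_vandermonde_neg {R : Type*} [CommRing R] {n : ℕ} (x : Fin n → R) :
    (Matrix.vandermonde fun i => -x i).det =
      (-1) ^ (∑ i : Fin n, (i : ℕ)) * (Matrix.vandermonde x).det := by
  rw [← prod_pow_eq_pow_sum, ← Matrix.det_mul_row]
  congr 1
  ext j k
  simp [Matrix.vandermonde_apply, neg_pow (x j)]

theorem card_of_mem_powersetCard {m n M : ℕ} (hM : m + n = M) :
    ∀ T ∈ powersetCard m (univ : Finset (Fin M)), #T = m ∧ #Tᶜ = n := by
  intro T hT
  rw [mem_powersetCard_univ] at hT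
  refine ⟨hT, ?_⟩
  rw [card_compl, Fintype.card_fin, hT]
  omega

/-- The Laplace expansion of the Vandermonde determinant in the variables `-x` and `y`. The signs
`-1` on the `x` cancel the signs of the expansion. -/
theorem prod_add_mul_det_vandermonde {R : Type*} [CommRing R] {m n M : ℕ} (hM : m + n = M)
    (x : Fin m → R) (y : Fin n → R) :
    (∏ i, ∏ k, (x i + y k)) * ((Matrix.vandermonde x).det * (Matrix.vandermonde y).det) =
      ∑ T ∈ (powersetCard m (univ : Finset (Fin M))).attach,
        (Matrix.of fun i k : Fin m =>
          x i ^ (T.1.orderEmbOfFin (card_of_mem_powersetCard hM T T.2).1 k : ℕ)).det *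
        (Matrix.of fun i k : Fin n =>
          y i ^ (T.1ᶜ.orderEmbOfFin (card_of_mem_powersetCard hM T T.2).2 k : ℕ)).det := by
  have hsq : ∀ a : ℕ, ((-1) ^ a * (-1) ^ a : R) = 1 := fun a => by
    rw [← mul_pow]; simp
  set A : Matrix (Fin m ⊕ Fin n) (Fin M) R :=
    Matrix.of fun i a => Sum.elim (fun j => -x j) y i ^ (a : ℕ) with hA
  have hdet : (A.submatrix id (finSumFinEquiv.trans (finCongr hM))).det =
      (-1) ^ (∑ i : Fin m, (i : ℕ)) * ((∏ i, ∏ k, (x i + y k)) *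
        ((Matrix.vandermonde x).det * (Matrix.vandermonde y).det)) := by
    have h1 : A.submatrix id (finSumFinEquiv.trans (finCongr hM)) =
        (Matrix.vandermonde (Fin.append (fun j => -x j) y)).submatrix
          finSumFinEquiv finSumFinEquiv := by
      ext i j
      rcases i with i | i <;> rcases j with j | j <;> simp [hA, Matrix.vandermonde_apply]
    rw [h1, Matrix.det_submatrix_equiv_self, Matrix.det_vandermonde, prod_pairs_fin_add]
    simp only [Fin.append_left, Fin.append_right]
    rw [← Matrix.det_vandermonde fun j => -x j, ← Matrix.det_vandermonde, det_vandermonde_neg]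
    simp only [sub_neg_eq_add, add_comm (y _)]
    ring
  have hexp := det_eq_sum_powersetCard A (finSumFinEquiv.trans (finCongr hM))
    (card_of_mem_powersetCard hM)
  rw [hdet] at hexp
  have hexp' := congrArg (fun r => (-1) ^ (∑ i : Fin m, (i : ℕ)) * r) hexp
  simp only [← mul_assoc, hsq, one_mul] at hexp'
  rw [mul_assoc] at hexp'
  rw [hexp', mul_sum]
  refine sum_congr rfl fun T _ => ?_
  obtain ⟨h1, h2⟩ := card_of_mem_powersetCard hM T T.2
  have hx : (A.submatrix Sum.inl (T.1.orderEmbOfFin h1)).det =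
      (-1) ^ (∑ i : Fin m, (T.1.orderEmbOfFin h1 i : ℕ)) *
        (Matrix.of fun i k : Fin m => x i ^ (T.1.orderEmbOfFin h1 k : ℕ)).det := by
    rw [← prod_pow_eq_pow_sum, ← Matrix.det_mul_row]
    congr 1
    ext j k
    simp [hA, neg_pow (x j)]
  have hsign := congrArg (fun z : ℤˣ => ((z : ℤ) : R)) (sign_finSumEquivOfFinset hM T.1 h1 h2)
  push_cast at hsign
  rw [hx, ← hsign]
  have hs1 : ∀ z : ℤˣ, ((z : ℤ) : R) * ((z : ℤ) : R) = 1 := fun z => by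
    rw [← Int.cast_mul, ← Units.val_mul, Int.units_mul_self]; simp
  have hy : (A.submatrix Sum.inr (T.1ᶜ.orderEmbOfFin h2)).det =
      (Matrix.of fun i k : Fin n => y i ^ (T.1ᶜ.orderEmbOfFin h2 k : ℕ)).det := by
    congr 1
  rw [hy]
  generalize Equiv.Perm.sign ((finSumEquivOfFinset h1 h2).trans
    (finSumFinEquiv.trans (finCongr hM)).symm) = z
  linear_combination (Matrix.of fun i k : Fin m => x i ^ (T.1.orderEmbOfFin h1 k : ℕ)).det *
    (Matrix.of fun i k : Fin n => y i ^ (T.1ᶜ.orderEmbOfFin h2 k : ℕ)).det *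
    (hsq (∑ i : Fin m, (i : ℕ)) * ((z : ℤ) : R) * ((z : ℤ) : R) + hs1 z)


/-! ### Partitions in a box and subsets -/

theorem add_le_of_strictMono_fin {n : ℕ} {g : Fin n → ℕ} (hg : StrictMono g) (d : ℕ) :
    ∀ k k' : Fin n, (k' : ℕ) = k + d → g k + d ≤ g k' := by
  induction d with
  | zero =>
    intro k k' h
    rw [Fin.ext (a := k') (b := k) (by omega), add_zero]
  | succ d ih =>
    intro k k' h
    have h1 := ih k ⟨k + d, by omega⟩ rfl
    have h2 : g ⟨k + d, by omega⟩ < g k' := hg (Fin.lt_def.2 (by simp only; omega))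
    omega

theorem le_of_strictMono_fin {n : ℕ} {g : Fin n → ℕ} (hg : StrictMono g) (k : Fin n) :
    (k : ℕ) ≤ g k := by
  have := add_le_of_strictMono_fin hg k ⟨0, k.pos⟩ k (by simp)
  omega

theorem nth_mem_eq_of_strictMono {s : Finset ℕ} {m : ℕ} (hs : #s = m) {g : Fin m → ℕ}
    (hg : StrictMono g) (hmem : ∀ k, g k ∈ s) (k : Fin m) :
    Nat.nth (fun x => x ∈ s) k = g k := by
  have hf : (Set.ofPred fun x => x ∈ s).Finite := s.finite_toSet
  have hfs : hf.toFinset = s := by ext; simp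
  have hk : (k : ℕ) < #hf.toFinset := by rw [hfs, hs]; exact k.2
  rw [Nat.nth_eq_orderEmbOfFin hf hk, orderEmbOfFin_unique (s := hf.toFinset) (by rw [hfs, hs])
    (f := g) (by simpa using hmem) hg]
  exact orderEmbOfFin_eq_orderEmbOfFin_iff.2 rfl

theorem mem_boxPartitions {N L : ℕ} {lam : Fin N → ℕ} :
    lam ∈ boxPartitions N L ↔ (∀ j, lam j ≤ L) ∧ Antitone lam := by
  simp [boxPartitions]

theorem strictMono_rev_add {N : ℕ} {lam : Fin N → ℕ} (h : Antitone lam) :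
    StrictMono fun k : Fin N => lam k.rev + (k : ℕ) := by
  intro i j hij
  have := h (Fin.rev_le_rev.2 hij.le)
  have := Fin.lt_def.1 hij
  simp only
  omega

/-- The hole positions of `lam`, shifted down by `1` so that the sites are the elements of
`Fin M`. -/
def holeSet (M : ℕ) {N : ℕ} (lam : Fin N → ℕ) : Finset (Fin M) :=
  {a | ∀ k : Fin N, (a : ℕ) ≠ lam k.rev + (k : ℕ)}

theorem mem_holeSet_compl {M N : ℕ} {lam : Fin N → ℕ} {a : Fin M} :
    a ∈ (holeSet M lam)ᶜ ↔ ∃ k : Fin N, (a : ℕ) = lam k.rev + (k : ℕ) := by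
  simp [holeSet]

theorem lam_rev_add_lt {M N : ℕ} (hNM : N ≤ M) {lam : Fin N → ℕ}
    (h : lam ∈ boxPartitions N (M - N)) (k : Fin N) : lam k.rev + (k : ℕ) < M := by
  have := (mem_boxPartitions.1 h).1 k.rev
  omega

theorem card_holeSet_compl {M N : ℕ} (hNM : N ≤ M) {lam : Fin N → ℕ}
    (h : lam ∈ boxPartitions N (M - N)) : #(holeSet M lam)ᶜ = N := by
  have hmono := strictMono_rev_add (mem_boxPartitions.1 h).2
  have : (holeSet M lam)ᶜ =
      univ.image fun k : Fin N => (⟨_, lam_rev_add_lt hNM h k⟩ : Fin M) := by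
    ext a
    rw [mem_holeSet_compl]
    simp [Fin.ext_iff, eq_comm]
  rw [this, card_image_of_injective, card_univ, Fintype.card_fin]
  intro i j hij
  exact hmono.injective (Fin.mk.inj hij)

theorem card_holeSet {M N : ℕ} (hNM : N ≤ M) {lam : Fin N → ℕ}
    (h : lam ∈ boxPartitions N (M - N)) : #(holeSet M lam) = M - N := by
  have := card_holeSet_compl hNM h
  rw [card_compl, Fintype.card_fin] at this
  have := card_le_univ (holeSet M lam)
  rw [Fintype.card_fin] at this
  omega

theorem orderEmbOfFin_holeSet_compl {M N : ℕ} (hNM : N ≤ M) {lam : Fin N → ℕ}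
    (h : lam ∈ boxPartitions N (M - N)) (hc : #(holeSet M lam)ᶜ = N) (k : Fin N) :
    ((holeSet M lam)ᶜ.orderEmbOfFin hc k : ℕ) = lam k.rev + (k : ℕ) := by
  have := orderEmbOfFin_unique hc
    (f := fun k : Fin N => (⟨_, lam_rev_add_lt hNM h k⟩ : Fin M))
    (fun k => mem_holeSet_compl.2 ⟨k, rfl⟩)
    fun i j hij => Fin.lt_def.2 (strictMono_rev_add (mem_boxPartitions.1 h).2 hij)
  rw [← this]

theorem succ_mem_holes_iff {M N : ℕ} {lam : Fin N → ℕ} {a : Fin M} :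
    (a : ℕ) + 1 ∈ holes M lam ↔ a ∈ holeSet M lam := by
  simp only [holes, particles, holeSet, mem_sdiff, mem_Icc, mem_image, mem_univ, true_and,
    mem_filter, not_exists]
  constructor
  · rintro ⟨-, h⟩ k hk
    apply h k.rev
    rw [hk, Fin.val_rev]
    omega
  · intro h
    refine ⟨by omega, fun j hj => h j.rev ?_⟩
    rw [Fin.rev_rev, Fin.val_rev]
    omega

theorem card_holes {M N : ℕ} (hNM : N ≤ M) {lam : Fin N → ℕ}
    (h : lam ∈ boxPartitions N (M - N)) : #(holes M lam) = M - N := by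
  rw [← card_holeSet hNM h, ← card_map (Fin.valEmbedding.trans (addRightEmbedding 1))]
  congr 1
  ext b
  rw [mem_map]
  constructor
  · intro hb
    have hb' := mem_Icc.1 (mem_sdiff.1 hb).1
    refine ⟨⟨b - 1, by omega⟩, succ_mem_holes_iff.1 ?_, ?_⟩
    · simpa [Nat.sub_add_cancel hb'.1] using hb
    · simp [Nat.sub_add_cancel hb'.1]
  · rintro ⟨a, ha, rfl⟩
    exact succ_mem_holes_iff.2 ha

theorem orderEmbOfFin_holeSet {M N : ℕ} (hNM : N ≤ M) {lam : Fin N → ℕ}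
    (h : lam ∈ boxPartitions N (M - N)) (hc : #(holeSet M lam) = M - N) (k : Fin (M - N)) :
    ((holeSet M lam).orderEmbOfFin hc k : ℕ) = barPartition M lam k.rev + (k : ℕ) := by
  have hmono : StrictMono fun k => ((holeSet M lam).orderEmbOfFin hc k : ℕ) :=
    fun i j hij => Fin.lt_def.1 (((holeSet M lam).orderEmbOfFin hc).strictMono hij)
  have hnth := nth_mem_eq_of_strictMono (card_holes hNM h)
    (g := fun k => ((holeSet M lam).orderEmbOfFin hc k : ℕ) + 1)
    (fun i j hij => Nat.succ_lt_succ (hmono hij))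
    (fun k => succ_mem_holes_iff.2 (orderEmbOfFin_mem _ hc k)) k
  have hidx : M - N - (k.rev : ℕ) = k + 1 := by rw [Fin.val_rev]; omega
  have hle := le_of_strictMono_fin hmono k
  rw [barPartition, holePos, hidx, Nat.add_sub_cancel, hnth]
  omega

/-- Summing over the partitions in the `N × (M - N)` box amounts to summing over the sets of hole
positions. -/
theorem sum_boxPartitions_eq_sum_powersetCard {R : Type*} [AddCommMonoid R] {M N : ℕ}
    (hNM : N ≤ M) (F : (Fin (M - N) → ℕ) → (Fin N → ℕ) → R) :
    ∑ lam ∈ boxPartitions N (M - N), F (fun k => barPartition M lam k.rev + (k : ℕ))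
        (fun k => lam k.rev + (k : ℕ)) =
      ∑ T ∈ (powersetCard (M - N) (univ : Finset (Fin M))).attach,
        F (fun k => T.1.orderEmbOfFin
            (card_of_mem_powersetCard (Nat.sub_add_cancel hNM) T T.2).1 k)
          (fun k => T.1ᶜ.orderEmbOfFin
            (card_of_mem_powersetCard (Nat.sub_add_cancel hNM) T T.2).2 k) := by
  refine sum_bij (fun lam h => ⟨holeSet M lam,
    mem_powersetCard_univ.2 (card_holeSet hNM h)⟩) (fun _ _ => mem_attach _ _) ?_ ?_ ?_
  · intro lam h lam' h' heq
    have heq' : holeSet M lam = holeSet M lam' := congrArg Subtype.val heq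
    have hc := card_holeSet_compl hNM h
    have hc' := card_holeSet_compl hNM h'
    funext j
    have h1 := orderEmbOfFin_holeSet_compl hNM h hc j.rev
    have h2 := orderEmbOfFin_holeSet_compl hNM h' hc' j.rev
    simp only [heq', Fin.rev_rev] at h1 h2
    omega
  · intro T _
    obtain ⟨hc1, hc2⟩ := card_of_mem_powersetCard (Nat.sub_add_cancel hNM) T T.2
    set g : Fin N → ℕ := fun k => T.1ᶜ.orderEmbOfFin hc2 k with hg
    have hmono : StrictMono g := fun i j hij =>
      Fin.lt_def.1 ((T.1ᶜ.orderEmbOfFin hc2).strictMono hij)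
    have hle := le_of_strictMono_fin hmono
    refine ⟨fun j => g j.rev - (j.rev : ℕ), mem_boxPartitions.2 ⟨fun j => ?_, fun i j hij => ?_⟩,
      Subtype.ext ?_⟩
    · -- the last `g` value is below `M`
      have h1 := add_le_of_strictMono_fin hmono j j.rev ⟨N - 1, Nat.sub_one_lt_of_lt j.pos⟩
        (by rw [Fin.val_rev]; simp only; omega)
      have h2 : g ⟨N - 1, Nat.sub_one_lt_of_lt j.pos⟩ < M := Fin.is_lt _
      rw [Fin.val_rev]
      omega
    · have h1 := add_le_of_strictMono_fin hmono (i.rev - j.rev : ℕ) j.rev i.rev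
        (by have := Fin.le_def.1 (Fin.rev_le_rev.2 hij); omega)
      have := Fin.le_def.1 (Fin.rev_le_rev.2 hij)
      have := hle j.rev
      simp only
      omega
    · rw [← compl_inj_iff]
      ext a
      rw [mem_holeSet_compl, ← mem_coe (s := T.1ᶜ), ← range_orderEmbOfFin T.1ᶜ hc2]
      simp only [Fin.rev_rev, Nat.sub_add_cancel (hle _)]
      simp only [Set.mem_range, Fin.ext_iff, hg, eq_comm]
  · intro lam h
    congr 1
    · funext k
      exact (orderEmbOfFin_holeSet hNM h _ k).symm
    · funext k
      exact (orderEmbOfFin_holeSet_compl hNM h _ k).symm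

/-! ### The dual Cauchy identity -/

theorem sum_schur_mul_schur {M N : ℕ} (hNM : N ≤ M) (x : Fin (M - N) → ℂ) (y : Fin N → ℂ) :
    ∑ lam ∈ boxPartitions N (M - N), schur (barPartition M lam) x * schur lam y =
      ∏ j, ∏ k, (x j + y k) := by
  -- the Vandermonde determinants can be cancelled when the variables are indeterminates
  set X : Fin (M - N) → MvPolynomial (Fin (M - N) ⊕ Fin N) ℂ := fun j => .X (.inl j) with hX
  set Y : Fin N → MvPolynomial (Fin (M - N) ⊕ Fin N) ℂ := fun k => .X (.inr k) with hY
  have hV : (Matrix.vandermonde X).det * (Matrix.vandermonde Y).det ≠ 0 :=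
    mul_ne_zero
      (Matrix.det_vandermonde_ne_zero_iff.2 fun i j h =>
        Sum.inl_injective (MvPolynomial.X_injective h))
      (Matrix.det_vandermonde_ne_zero_iff.2 fun i j h =>
        Sum.inr_injective (MvPolynomial.X_injective h))
  have key : ∑ lam ∈ boxPartitions N (M - N), MvPolynomial.aeval X (schurPoly (barPartition M lam)) *
      MvPolynomial.aeval Y (schurPoly lam) = ∏ j, ∏ k, (X j + Y k) := by
    refine mul_right_cancel₀ hV ?_
    rw [prod_add_mul_det_vandermonde (Nat.sub_add_cancel hNM),
      ← sum_boxPartitions_eq_sum_powersetCard hNM fun a b =>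
        (Matrix.of fun i k => X i ^ a k).det * (Matrix.of fun i k => Y i ^ b k).det, sum_mul]
    refine sum_congr rfl fun lam _ => ?_
    rw [← det_vandermonde_mul_aeval_schurPoly, ← det_vandermonde_mul_aeval_schurPoly]
    ring
  have := congrArg (MvPolynomial.aeval (Sum.elim x y)) key
  simpa only [schur, map_sum, map_mul, map_prod, map_add, hX, hY, MvPolynomial.aeval_X, Sum.elim_inl,
    Sum.elim_inr, MvPolynomial.comp_aeval_apply, MvPolynomial.aeval_eq_eval] using this

theorem schurSum_eq_prod {M N : ℕ} (hNM : N ≤ M) (x y : ℕ → ℂ) :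
    schurSum M N x y = ∏ j ∈ Icc 1 (M - N), ∏ k ∈ Icc (M - N + 1) M, (x j + y k) := by
  have hI : ∀ (a b : ℕ) (G : ℕ → ℂ), ∏ k ∈ Icc (a + 1) b, G k =
      ∏ k : Fin (b - a), G (a + 1 + k) := fun a b G => by
    have : Icc (a + 1) b = Ico (a + 1) (b + 1) := by ext; simp
    rw [this, prod_Ico_eq_prod_range, Nat.add_sub_add_right, prod_range]
  rw [schurSum, sum_schur_mul_schur hNM, hI 0 (M - N)]
  refine prod_congr rfl fun j _ => ?_
  rw [hI, ← prod_range fun k => x (0 + 1 + j) + y (M - N + 1 + k), Nat.sub_sub_self hNM,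
    prod_range, zero_add, add_comm 1]

end FelderhofDualCauchy

theorem mainTheorem4 (M N : ℕ) (hNM : N ≤ M) :
    -- the identity for generic parameters
    (∀ (p q : ℂ) (u : ℕ → ℂ), p ≠ 0 → q ^ 2 ≠ 1 →
      (∀ j ∈ Finset.Icc 1 M, 1 - p * q * u j ≠ 0) →
      (∀ j ∈ Finset.Icc 1 (M - N), 1 - p⁻¹ * q * u j ≠ 0) →
      FelderhofDualCauchy.prodB M N p q u ≠ 0 →
      FelderhofDualCauchy.prodC M N p q u ≠ 0 →
      FelderhofDualCauchy.schurSum M N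
          (fun j => FelderhofDualCauchy.zVar p q (u j) / (-p ^ 2))
          (fun k => FelderhofDualCauchy.wVar p q (u k)) =
        FelderhofDualCauchy.dualCauchyRHS M N p q u) ∧
    -- at `q = 0` both variables become `u` and the right-hand side becomes the classical product
    (∀ (p : ℂ) (u : ℕ → ℂ), p ≠ 0 →
      (∀ j, FelderhofDualCauchy.zVar p 0 (u j) = u j ∧ FelderhofDualCauchy.wVar p 0 (u j) = u j) ∧
      (FelderhofDualCauchy.prodB M N p 0 u ≠ 0 → FelderhofDualCauchy.prodC M N p 0 u ≠ 0 →
        FelderhofDualCauchy.dualCauchyRHS M N p 0 u =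
          ∏ j ∈ Finset.Icc 1 (M - N), ∏ k ∈ Finset.Icc (M - N + 1) M, (u j / (-p ^ 2) + u k))) ∧
    -- the classical dual Cauchy identity, in the form obtained at `q = 0` with `t = -p ^ 2`
    (∀ (t : ℂ) (u : ℕ → ℂ), t ≠ 0 →
      FelderhofDualCauchy.schurSum M N (fun j => u j / t) u =
        ∏ j ∈ Finset.Icc 1 (M - N), ∏ k ∈ Finset.Icc (M - N + 1) M, (u j / t + u k)) ∧
    -- and after replacing `u` by `t * u`
    (∀ (t : ℂ) (u : ℕ → ℂ),
      FelderhofDualCauchy.schurSum M N u (fun k => t * u k) =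
        ∏ j ∈ Finset.Icc 1 (M - N), ∏ k ∈ Finset.Icc (M - N + 1) M, (u j + t * u k)) := by
  refine ⟨?_, ?_, ?_, ?_⟩
  · intro p q u hp hq hw hz hB hC
    rw [FelderhofDualCauchy.schurSum_eq_prod hNM,
      FelderhofDualCauchy.dualCauchyRHS_eq_prod hNM hp hq hw hz hB hC]
  · intro p u hp
    refine ⟨fun j => ⟨FelderhofDualCauchy.zVar_zero _ _, FelderhofDualCauchy.wVar_zero _ _⟩,
      fun hB hC => ?_⟩
    rw [FelderhofDualCauchy.dualCauchyRHS_eq_prod hNM hp (by simp) (by simp) (by simp) hB hC]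
    simp only [FelderhofDualCauchy.zVar_zero, FelderhofDualCauchy.wVar_zero]
  · intro t u _
    exact FelderhofDualCauchy.schurSum_eq_prod hNM _ _
  · intro t u
    exact FelderhofDualCauchy.schurSum_eq_prod hNM _ _
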